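/- Consider finite simple undirected graphs $G=(V,E)$ whose nodes carry colors from a finite palette $P$ (each node may carry any set of colors), and let $\rho(u,v)$ be the length of a shortest path between $u$ and $v$ ($\infty$ if there is none) and $\mathcal N_i(u)=\{v\in V:\rho(u,v)=i\}$. Let $k\ge 1$. The logic $\mathsf C^2_k$ is two-variable first-order logic with counting quantifiers $\exists^{\ge m}$, $m\in\mathbb N$, over the colors (as unary predicates), equality, the edge relation $E$, and the binary predicates $E_i$, $2\le i\le k$, where $E_i(u,v)$ holds if and only if $\rho(u,v)=i$. A $\mathsf C^2_k$ node classifier is a $\mathsf C^2_k$ formula $\phi(x)$ with no free variable other than $x$. A shortest path message passing network (SP-MPNN) with global readout has finitely many layers, each of which updates the node states (real vectors) by $$\mathbf h_u^{(t+1)}=\mathsf{COM}^{(t)}\Big(\mathbf h_u^{(t)},\ \big(\mathsf{AGG}^{(t)}_i(\mathbf h_u^{(t)},\{\!\!\{\mathbf h_v^{(t)}: v\in\mathcal N_i(u)\}\!\!\})\big)_{1\le i\le k},\ \mathsf{READ}^{(t)}(\mathbf h_u^{(t)},\{\!\!\{\mathbf h_v^{(t)}: v\in V\}\!\!\})\Big).$$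 The initial state of $u$ has a coordinate for each color, equal to $1$ if $u$ has that color and $0$ otherwise, and possibly further coordinates equal to $0$. The network maps $(G,u)$ to true if and only if a designated coordinate of the final state of $u$ is at least $1/2$. It captures $\phi(x)$ if, for all colored graphs $G$ and all nodes $u$ of $G$, it maps $(G,u)$ to true if and only if $G\models\phi(u)$. Theorem. For every $k\ge 1$, every $\mathsf C^2_k$ node classifier $\phi(x)$ is captured by an SP-MPNN with global readout (using the hops $1,\dots,k$) all of whose functions $\mathsf{COM}^{(t)},\mathsf{AGG}_i^{(t)},\mathsf{READ}^{(t)}$ are differentiable, and it is also captured by a homogeneous SP-MPNN with global readout whose layers all have the form $$\mathbf h_u^{(t+1)}=f\Big(\mathbf h_u^{(t)}\mathbf C+\sum_{i=1}^k\big(\sum_{v\in\mathcal N_i(u)}\mathbf h_v^{(t)}\big)\mathbf A_i+\big(\sum_{v\in V}\mathbf h_v^{(t)}\big)\mathbf R+\mathbf b\Big)$$ with real matrices $\mathbf C,\mathbf A_1,\dots,\mathbf A_k,\mathbf R$, a real vector $\mathbf b$ and the truncated ReLU $f(x)=\max(0,\min(x,1))$ applied coordinatewise. -/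

import Mathlib

open scoped Matrix

/-- A simple undirected graph on `V` whose nodes carry colors from the palette `P`. A node may
carry any set of colors; exactly one color per node is a special case. -/
structure ColoredGraph (V P : Type*) where
  graph : SimpleGraph V
  color : V → Set P

/-- Formulas of two-variable counting logic over unary color predicates, equality, the edge
relation and the shortest-path predicates `E_i`, `2 ≤ i ≤ k`. The two variables are the elements
of `Fin 2`. The quantifier `exGE N y` is `∃^{≥ N} y`; in particular `∃ y` is `exGE 1 y` and
`∀ y` is `¬ ∃ y ¬`. -/
inductive C2Formula (k : ℕ) (P : Type*) where
  | color (p : P) (x : Fin 2)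
  | eq (x y : Fin 2)
  | edge (x y : Fin 2)
  | spath (i : ℕ) (two_le : 2 ≤ i) (le_k : i ≤ k) (x y : Fin 2)
  | neg (φ : C2Formula k P)
  | and (φ ψ : C2Formula k P)
  | or (φ ψ : C2Formula k P)
  | exGE (N : ℕ) (y : Fin 2) (φ : C2Formula k P)

namespace C2Formula

variable {k : ℕ} {P : Type*}

/-- The free variables of a formula. -/
def freeVars : C2Formula k P → Finset (Fin 2)
  | color _ x => {x}
  | eq x y => {x, y}
  | edge x y => {x, y}
  | spath _ _ _ x y => {x, y}
  | neg φ => φ.freeVars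
  | and φ ψ => φ.freeVars ∪ ψ.freeVars
  | or φ ψ => φ.freeVars ∪ ψ.freeVars
  | exGE _ y φ => φ.freeVars.erase y

/-- Truth of a formula in a (finite) colored graph under an assignment of the two variables.
`SimpleGraph.edist` is the length of a shortest path, and `⊤` if there is no path. -/
def Realize {V : Type*} (X : ColoredGraph V P) : C2Formula k P → (Fin 2 → V) → Prop
  | color p x, a => p ∈ X.color (a x)
  | eq x y, a => a x = a y
  | edge x y, a => X.graph.Adj (a x) (a y)
  | spath i _ _ x y, a => X.graph.edist (a x) (a y) = (i : ℕ∞)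
  | neg φ, a => ¬ φ.Realize X a
  | and φ ψ, a => φ.Realize X a ∧ ψ.Realize X a
  | or φ ψ, a => φ.Realize X a ∨ ψ.Realize X a
  | exGE N y φ, a => N ≤ {v : V | φ.Realize X (Function.update a y v)}.ncard

end C2Formula

open Classical in
/-- The `i`-hop shortest path neighborhood `{v | ρ(u, v) = i}`. -/
noncomputable def hopNeighborhood {V : Type*} [Fintype V] (G : SimpleGraph V) (i : ℕ) (u : V) :
    Finset V :=
  Finset.univ.filter fun v => G.edist u v = (i : ℕ∞)

/-- A shortest path message passing neural network (aggregating over the hops `1, …, k`) with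
global readout, used as a node classifier for graphs with colors from `P`. Layer `t` maps the
states in `ℝ^(dim t)` to states in `ℝ^(dim (t + 1))`; `agg t i` is the aggregation function for hop
`i + 1`. Permutation invariance of aggregation and readout is built in, as these are functions of
multisets. The initial state has one coordinate per color (the field `input` says which one). -/
structure SPMPNN (k : ℕ) (P : Type*) where
  /-- number of layers -/
  depth : ℕ
  /-- dimensions of the states, the aggregated messages and the readout vectors -/
  dim : ℕ → ℕ
  aggDim : ℕ → Fin k → ℕ
  readDim : ℕ → ℕ
  agg : (t : ℕ) → (i : Fin k) → (Fin (dim t) → ℝ) → Multiset (Fin (dim t) → ℝ) →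
    (Fin (aggDim t i) → ℝ)
  read : (t : ℕ) → (Fin (dim t) → ℝ) → Multiset (Fin (dim t) → ℝ) → (Fin (readDim t) → ℝ)
  com : (t : ℕ) → (Fin (dim t) → ℝ) → ((i : Fin k) → Fin (aggDim t i) → ℝ) →
    (Fin (readDim t) → ℝ) → (Fin (dim (t + 1)) → ℝ)
  /-- the coordinate of the initial state that holds a given color -/
  input : P ↪ Fin (dim 0)
  /-- the coordinate of the final state that holds the answer -/
  output : Fin (dim depth)

namespace SPMPNN

variable {k : ℕ} {P : Type*}

open Classical in
/-- The state of each node after `t` layers. Initially a coordinate that belongs to a color is `1`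
if the node has this color, and all other coordinates are `0`. -/
noncomputable def state (M : SPMPNN k P) {V : Type*} [Fintype V] (X : ColoredGraph V P) :
    (t : ℕ) → V → (Fin (M.dim t) → ℝ)
  | 0, u => fun j => if ∃ p ∈ X.color u, M.input p = j then 1 else 0
  | t + 1, u =>
    M.com t (M.state X t u)
      (fun i => M.agg t i (M.state X t u)
        ((hopNeighborhood X.graph ((i : ℕ) + 1) u).val.map (M.state X t)))
      (M.read t (M.state X t u) ((Finset.univ : Finset V).val.map (M.state X t)))

/-- The network accepts the node `u` if the output coordinate of its final state is at least
`1 / 2`. -/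
def Accepts (M : SPMPNN k P) {V : Type*} [Fintype V] (X : ColoredGraph V P) (u : V) : Prop :=
  (1 / 2 : ℝ) ≤ M.state X M.depth u M.output

/-- `M` captures the node classifier `φ(x)`: on every finite colored graph `X`, it accepts
exactly the nodes `u` such that `φ` is true in `X` when `x` is interpreted as `u`. -/
def Captures (M : SPMPNN k P) (φ : C2Formula k P) (x : Fin 2) : Prop :=
  ∀ (V : Type) [Fintype V] (X : ColoredGraph V P) (a : Fin 2 → V),
    M.Accepts X (a x) ↔ φ.Realize X a

/-- All aggregation, readout and combination functions are differentiable. A function of a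
multiset is differentiable if it is so, for every `n`, as a function of `n` vectors that are the
members of the multiset. -/
def IsDifferentiable (M : SPMPNN k P) : Prop :=
  ∀ t : ℕ,
    (∀ (i : Fin k) (n : ℕ), Differentiable ℝ
      fun z : (Fin (M.dim t) → ℝ) × (Fin n → Fin (M.dim t) → ℝ) =>
        M.agg t i z.1 ((Finset.univ : Finset (Fin n)).val.map z.2)) ∧
    (∀ n : ℕ, Differentiable ℝ
      fun z : (Fin (M.dim t) → ℝ) × (Fin n → Fin (M.dim t) → ℝ) =>
        M.read t z.1 ((Finset.univ : Finset (Fin n)).val.map z.2)) ∧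
    Differentiable ℝ
      fun z : (Fin (M.dim t) → ℝ) × ((i : Fin k) → Fin (M.aggDim t i) → ℝ) ×
          (Fin (M.readDim t) → ℝ) =>
        M.com t z.1 z.2.1 z.2.2

/-- The homogeneous network with `L` identical layers
`h_u ↦ f (h_u C + ∑ i, (∑ v ∈ N_i(u), h_v) A_i + (∑ v, h_v) R + b)`, where `f` acts
coordinatewise. -/
def ofMatrices (f : ℝ → ℝ) (L d : ℕ) (C : Matrix (Fin d) (Fin d) ℝ)
    (A : Fin k → Matrix (Fin d) (Fin d) ℝ) (R : Matrix (Fin d) (Fin d) ℝ) (b : Fin d → ℝ)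
    (input : P ↪ Fin d) (output : Fin d) : SPMPNN k P where
  depth := L
  dim _ := d
  aggDim _ _ := d
  readDim _ := d
  agg _ i _ S := S.sum ᵥ* A i
  read _ _ S := S.sum ᵥ* R
  com _ h m r := fun j => f ((h ᵥ* C + ∑ i, m i + r + b) j)
  input := input
  output := output

end SPMPNN

/-- The truncated ReLU. -/
noncomputable def truncReLU (x : ℝ) : ℝ := max 0 (min x 1)

/-! With two variables, a formula sees a pair of nodes only through their distance, capped at `k`,
and through what is true at each node alone. By induction (`C2Formula.exists_determinedBy`) its
truth depends only on this hop class and on which of finitely many node formulas hold at the two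
nodes. For a quantifier, the type `σ` of the remaining node is one of finitely many; once `σ` is
fixed, the counted condition on `v` depends only on the hop class and on the type of `v`, so a
single `count` expresses it.

A network then has one coordinate per subformula. Nodes farther than `k` are counted as all nodes
(the readout) minus those at distances `0, …, k` (`HopFormula.ncard_eq_sum_value`). Every gate is an
integer affine form that is at least `1` if the formula holds and at most `0` otherwise, so any
activation that is `0` on integers `≤ 0` and `1` on integers `≥ 1` works. The truncated ReLU is one;
`Real.smoothTransition` is a differentiable one, and the same matrices serve both. -/

/-! ### Hop classes and node formulas -/

/-- Node formulas whose only quantifier counts the nodes `v` that satisfy the formula assigned to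
the hop class of `(u, v)`. The class `some i` means distance `i ≤ k`, the class `none` means
distance greater than `k`. -/
inductive HopFormula (k : ℕ) (P : Type*) where
  | color (p : P)
  | tru
  | neg (φ : HopFormula k P)
  | and (φ ψ : HopFormula k P)
  | count (N : ℕ) (φ : Option (Fin (k + 1)) → HopFormula k P)

open Classical in
/-- The distance of two nodes if it is at most `k`, and `none` otherwise. -/
noncomputable def hopClass (k : ℕ) {V : Type*} (G : SimpleGraph V) (u v : V) :
    Option (Fin (k + 1)) :=
  if h : ∃ i : Fin (k + 1), G.edist u v = ((i : ℕ) : ℕ∞) then some h.choose else none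

theorem hopClass_eq_some_iff {k : ℕ} {V : Type*} {G : SimpleGraph V} {u v : V} {i : Fin (k + 1)} :
    hopClass k G u v = some i ↔ G.edist u v = ((i : ℕ) : ℕ∞) := by
  unfold hopClass
  split_ifs with h
  · have hc := h.choose_spec
    constructor
    · intro hi
      rw [Option.some.injEq] at hi
      rwa [hi] at hc
    · intro hi
      rw [hc] at hi
      exact congrArg some (Fin.ext (by exact_mod_cast hi))
  · simp only [false_iff]
    exact fun hi => h ⟨i, hi⟩

theorem hopClass_self (k : ℕ) {V : Type*} (G : SimpleGraph V) (u : V) :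
    hopClass k G u u = some 0 := by
  simp [hopClass_eq_some_iff]

theorem hopClass_eq_some_zero_iff {k : ℕ} {V : Type*} {G : SimpleGraph V} {u v : V} :
    hopClass k G u v = some 0 ↔ u = v := by
  simp [hopClass_eq_some_iff]

theorem hopClass_comm (k : ℕ) {V : Type*} (G : SimpleGraph V) (u v : V) :
    hopClass k G u v = hopClass k G v u := by
  simp only [hopClass, G.edist_comm (u := u)]

namespace HopFormula

variable {k : ℕ} {P : Type*}

/-- Truth of a node formula at a node. -/
def Realize {V : Type*} (X : ColoredGraph V P) : HopFormula k P → V → Prop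
  | color p, u => p ∈ X.color u
  | tru, _ => True
  | neg φ, u => ¬ φ.Realize X u
  | and φ ψ, u => φ.Realize X u ∧ ψ.Realize X u
  | count N φ, u => N ≤ {v : V | (φ (hopClass k X.graph u v)).Realize X v}.ncard

/-- The number of layers after which a homogeneous network has evaluated the formula. -/
def depth : HopFormula k P → ℕ
  | color _ => 0
  | tru => 1
  | neg φ => φ.depth + 1
  | and φ ψ => max φ.depth ψ.depth + 1
  | count _ φ => (Finset.univ.sup fun r => (φ r).depth) + 1

open Classical in
/-- The immediate subformulas. -/
noncomputable def children : HopFormula k P → Finset (HopFormula k P)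
  | color _ => ∅
  | tru => ∅
  | neg φ => {φ}
  | and φ ψ => {φ, ψ}
  | count _ φ => Finset.univ.image φ

/-- Supplies the coordinates of the network. Finiteness holds because `count` branches only over the
finitely many hop classes. -/
theorem exists_closed_finset (φ : HopFormula k P) :
    ∃ S : Finset (HopFormula k P), φ ∈ S ∧ ∀ ψ ∈ S, ψ.children ⊆ S := by
  classical
  have key : ∀ φ : HopFormula k P,
      (∀ χ ∈ φ.children, ∃ S : Finset (HopFormula k P), χ ∈ S ∧ ∀ ψ ∈ S, ψ.children ⊆ S) →
      ∃ S : Finset (HopFormula k P), φ ∈ S ∧ ∀ ψ ∈ S, ψ.children ⊆ S := by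
    intro φ h
    choose! S hS hcl using h
    refine ⟨insert φ (φ.children.biUnion S), Finset.mem_insert_self _ _, fun ψ hψ χ hχ => ?_⟩
    refine Finset.mem_insert_of_mem (Finset.mem_biUnion.2 ?_)
    rcases Finset.mem_insert.1 hψ with rfl | hψ
    · exact ⟨χ, hχ, hS χ hχ⟩
    · obtain ⟨ξ, hξ, hψξ⟩ := Finset.mem_biUnion.1 hψ
      exact ⟨ξ, hξ, hcl ξ hξ ψ hψξ hχ⟩
  induction φ with
  | color p => exact key _ (by simp [children])
  | tru => exact key _ (by simp [children])
  | neg φ ih => exact key _ (by simpa [children] using ih)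
  | and φ ψ ih₁ ih₂ => exact key _ (by simpa [children] using ⟨ih₁, ih₂⟩)
  | count N φ ih => exact key _ (by simpa [children] using ih)

open Classical in
/-- The formulas of `S` that are true at a node. -/
noncomputable def trueAt (S : Finset (HopFormula k P)) {V : Type*} (X : ColoredGraph V P) (u : V) :
    Finset (HopFormula k P) :=
  S.filter fun ψ => ψ.Realize X u

open Classical in
theorem trueAt_inter {S S' : Finset (HopFormula k P)} (h : S ⊆ S') {V : Type*}
    (X : ColoredGraph V P) (u : V) : trueAt S' X u ∩ S = trueAt S X u := by
  ext ψ
  simp only [trueAt, Finset.mem_inter, Finset.mem_filter]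
  exact ⟨fun h' => ⟨h'.2, h'.1.2⟩, fun h' => ⟨⟨h h'.1, h'.2⟩, h'.1⟩⟩

/-- Every property of the set of true formulas of a finite set `S` is expressible. -/
theorem exists_realize_iff_trueAt (S : Finset (HopFormula k P))
    (T : Finset (HopFormula k P) → Prop) :
    ∃ ψ : HopFormula k P, ∀ (V : Type) (X : ColoredGraph V P) (u : V),
      ψ.Realize X u ↔ T (trueAt S X u) := by
  classical
  induction S using Finset.induction_on generalizing T with
  | empty =>
    by_cases h : T ∅
    · exact ⟨tru, fun V X u => by simp [Realize, trueAt, h]⟩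
    · exact ⟨neg tru, fun V X u => by simp [Realize, trueAt, h]⟩
  | insert χ S _ ih =>
    obtain ⟨ψ₁, h₁⟩ := ih fun τ => T (insert χ τ)
    obtain ⟨ψ₂, h₂⟩ := ih T
    -- "If `χ` then `ψ₁` else `ψ₂`", with the disjunction written by De Morgan.
    refine ⟨neg (and (neg (and χ ψ₁)) (neg (and (neg χ) ψ₂))), fun V X u => ?_⟩
    have hins : trueAt (insert χ S) X u =
        if χ.Realize X u then insert χ (trueAt S X u) else trueAt S X u :=
      Finset.filter_insert ..
    rw [hins]
    simp only [Realize, h₁, h₂]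
    by_cases hχ : χ.Realize X u <;> simp [hχ]

end HopFormula

/-! ### From two-variable formulas to node formulas -/

namespace C2Formula

variable {k : ℕ} {P : Type*}

theorem realize_congr {V : Type*} (X : ColoredGraph V P) (φ : C2Formula k P) {a a' : Fin 2 → V}
    (h : ∀ z ∈ φ.freeVars, a z = a' z) : φ.Realize X a ↔ φ.Realize X a' := by
  induction φ generalizing a a' with
  | color p x => simp_all [Realize, freeVars]
  | eq x y => simp_all [Realize, freeVars]
  | edge x y => simp_all [Realize, freeVars]
  | spath i _ _ x y => simp_all [Realize, freeVars]
  | neg φ ih => exact not_congr (ih h)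
  | and φ ψ ih₁ ih₂ =>
    exact and_congr (ih₁ fun z hz => h z (Finset.mem_union_left _ hz))
      (ih₂ fun z hz => h z (Finset.mem_union_right _ hz))
  | or φ ψ ih₁ ih₂ =>
    exact or_congr (ih₁ fun z hz => h z (Finset.mem_union_left _ hz))
      (ih₂ fun z hz => h z (Finset.mem_union_right _ hz))
  | exGE N y φ ih =>
    have hset : {v : V | φ.Realize X (Function.update a y v)} =
        {v : V | φ.Realize X (Function.update a' y v)} := by
      ext v
      refine ih fun z hz => ?_
      by_cases hzy : z = y
      · subst hzy; simp
      · simpa [hzy] using h z (Finset.mem_erase.2 ⟨hzy, hz⟩)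
    simp only [Realize, hset]

/-- The truth of `φ` is a function of the hop class of the pair of nodes and of the formulas from
a finite set of node formulas that hold at these nodes. -/
def DeterminedBy (φ : C2Formula k P) (S : Finset (HopFormula k P))
    (F : Option (Fin (k + 1)) → (Fin 2 → Finset (HopFormula k P)) → Prop) : Prop :=
  ∀ (V : Type) [Finite V] (X : ColoredGraph V P) (a : Fin 2 → V),
    φ.Realize X a ↔ F (hopClass k X.graph (a 0) (a 1)) fun z => HopFormula.trueAt S X (a z)

theorem DeterminedBy.mono {φ : C2Formula k P} {S S' : Finset (HopFormula k P)}
    {F : Option (Fin (k + 1)) → (Fin 2 → Finset (HopFormula k P)) → Prop}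
    (h : φ.DeterminedBy S F) (hS : S ⊆ S') :
    ∃ F', φ.DeterminedBy S' F' := by
  classical
  refine ⟨fun r τ => F r fun z => τ z ∩ S, fun V _ X a => ?_⟩
  simp only [HopFormula.trueAt_inter hS]
  exact h V X a

/-- Covers all binary atoms: equality is distance `0`, adjacency is distance `1`, and `spath i` is
distance `i`. -/
theorem determinedBy_distance {φ : C2Formula k P} {i : Fin (k + 1)} {x y : Fin 2}
    (h : ∀ (V : Type) (X : ColoredGraph V P) (a : Fin 2 → V),
      φ.Realize X a ↔ X.graph.edist (a x) (a y) = ((i : ℕ) : ℕ∞)) :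
    ∃ F, φ.DeterminedBy ∅ F := by
  refine ⟨fun r _ => (if x = y then some 0 else r) = some i, fun V _ X a => ?_⟩
  rw [h, ← hopClass_eq_some_iff]
  fin_cases x <;> fin_cases y <;> simp [hopClass_self]
  rw [hopClass_comm]

theorem exists_determinedBy (hk : 1 ≤ k) (φ : C2Formula k P) :
    ∃ S F, φ.DeterminedBy S F := by
  classical
  induction φ with
  | color p x =>
    refine ⟨{.color p}, fun _ τ => .color p ∈ τ x, fun V _ X a => ?_⟩
    simp [HopFormula.trueAt, HopFormula.Realize, Realize]
  | eq x y =>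
    exact ⟨∅, determinedBy_distance (i := 0) (x := x) (y := y) fun V X a => by simp [Realize]⟩
  | edge x y =>
    refine ⟨∅, determinedBy_distance (i := ⟨1, by omega⟩) (x := x) (y := y) fun V X a => ?_⟩
    simp [Realize, SimpleGraph.edist_eq_one_iff_adj]
  | spath i h₁ h₂ x y =>
    exact ⟨∅, determinedBy_distance (i := ⟨i, by omega⟩) (x := x) (y := y) fun V X a => Iff.rfl⟩
  | neg φ ih =>
    obtain ⟨S, F, h⟩ := ih
    exact ⟨S, fun r τ => ¬ F r τ, fun V _ X a => not_congr (h V X a)⟩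
  | and φ ψ ih₁ ih₂ =>
    obtain ⟨S₁, F₁, h₁⟩ := ih₁
    obtain ⟨S₂, F₂, h₂⟩ := ih₂
    obtain ⟨F₁', h₁'⟩ := h₁.mono (Finset.subset_union_left (s₂ := S₂))
    obtain ⟨F₂', h₂'⟩ := h₂.mono (Finset.subset_union_right (s₁ := S₁))
    exact ⟨_, fun r τ => F₁' r τ ∧ F₂' r τ, fun V _ X a => and_congr (h₁' V X a) (h₂' V X a)⟩
  | or φ ψ ih₁ ih₂ =>
    obtain ⟨S₁, F₁, h₁⟩ := ih₁
    obtain ⟨S₂, F₂, h₂⟩ := ih₂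
    obtain ⟨F₁', h₁'⟩ := h₁.mono (Finset.subset_union_left (s₂ := S₂))
    obtain ⟨F₂', h₂'⟩ := h₂.mono (Finset.subset_union_right (s₁ := S₁))
    exact ⟨_, fun r τ => F₁' r τ ∨ F₂' r τ, fun V _ X a => or_congr (h₁' V X a) (h₂' V X a)⟩
  | exGE N y φ ih =>
    obtain ⟨S, F, h⟩ := ih
    choose ψ hψ using fun (σ : Finset (HopFormula k P)) (r : Option (Fin (k + 1))) =>
      HopFormula.exists_realize_iff_trueAt S fun τ => F r (Function.update (fun _ => σ) y τ)
    -- `G σ` is correct only at nodes of type `σ`. All the `G σ` are added to the finite set, and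
    -- the one matching the actual type, recovered by intersecting with `S`, is consulted.
    let G : Finset (HopFormula k P) → HopFormula k P := fun σ => .count N (ψ σ)
    refine ⟨S ∪ S.powerset.image G, fun _ τ => G (τ (1 - y) ∩ S) ∈ τ (1 - y), fun V _ X a => ?_⟩
    beta_reduce
    rw [HopFormula.trueAt_inter Finset.subset_union_left]
    have hmem : G (HopFormula.trueAt S X (a (1 - y))) ∈ S ∪ S.powerset.image G :=
      Finset.mem_union_right _ (Finset.mem_image_of_mem _
        (Finset.mem_powerset.2 (Finset.filter_subset _ _)))
    rw [HopFormula.trueAt, Finset.mem_filter, and_iff_right hmem]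
    have hset : {v : V | φ.Realize X (Function.update a y v)} =
        {v : V | (ψ (HopFormula.trueAt S X (a (1 - y)))
          (hopClass k X.graph (a (1 - y)) v)).Realize X v} := by
      ext v
      simp only [Set.mem_ofPred_eq, hψ]
      rw [h]
      have h₁ : hopClass k X.graph (Function.update a y v 0) (Function.update a y v 1) =
          hopClass k X.graph (a (1 - y)) v := by
        fin_cases y
        · simpa using hopClass_comm k X.graph _ _
        · simp
      have h₂ : (fun z => HopFormula.trueAt S X (Function.update a y v z)) =
          Function.update (fun _ => HopFormula.trueAt S X (a (1 - y))) y
            (HopFormula.trueAt S X v) := by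
        funext z
        fin_cases y <;> fin_cases z <;> simp
      rw [h₁, h₂]
    simp only [Realize, G, HopFormula.Realize, hset]

/-- A formula with one free variable is equivalent to a node formula. -/
theorem exists_hopFormula (hk : 1 ≤ k) (φ : C2Formula k P) {x : Fin 2} (hφ : φ.freeVars ⊆ {x}) :
    ∃ ψ : HopFormula k P, ∀ (V : Type) [Finite V] (X : ColoredGraph V P) (a : Fin 2 → V),
      ψ.Realize X (a x) ↔ φ.Realize X a := by
  obtain ⟨S, F, h⟩ := φ.exists_determinedBy hk
  obtain ⟨ψ, hψ⟩ := HopFormula.exists_realize_iff_trueAt S fun τ => F (some 0) fun _ => τ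
  refine ⟨ψ, fun V _ X a => ?_⟩
  -- The other variable is not free, so it may be placed on the same node, which makes the hop class
  -- `some 0`.
  rw [hψ, φ.realize_congr X (a' := fun _ => a x), h, hopClass_self]
  intro z hz
  rw [Finset.mem_singleton.1 (hφ hz)]

end C2Formula

/-! ### Layers of homogeneous networks -/

namespace SPMPNN

variable {k : ℕ} {P : Type*}

open Classical in
theorem state_zero_input (M : SPMPNN k P) {V : Type*} [Fintype V] (X : ColoredGraph V P) (u : V)
    (p : P) : M.state X 0 u (M.input p) = if p ∈ X.color u then 1 else 0 := by
  simp [state]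

theorem state_ofMatrices_succ (f : ℝ → ℝ) (L d : ℕ) (C : Matrix (Fin d) (Fin d) ℝ)
    (A : Fin k → Matrix (Fin d) (Fin d) ℝ) (R : Matrix (Fin d) (Fin d) ℝ) (b : Fin d → ℝ)
    (input : P ↪ Fin d) (output : Fin d) {V : Type*} [Fintype V] (X : ColoredGraph V P)
    (t : ℕ) (u : V) (j : Fin d) :
    let h : V → Fin d → ℝ := (ofMatrices f L d C A R b input output).state X t
    ((ofMatrices f L d C A R b input output).state X (t + 1) u : Fin d → ℝ) j =
      f (∑ i, h u i * C i j
        + ∑ l : Fin k, ∑ i, (∑ v ∈ hopNeighborhood X.graph ((l : ℕ) + 1) u, h v i) * A l i j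
        + ∑ i, (∑ v, h v i) * R i j + b j) := by
  intro h
  change f ((h u ᵥ* C + ∑ l : Fin k, (∑ v ∈ hopNeighborhood X.graph ((l : ℕ) + 1) u, h v) ᵥ* A l
    + (∑ v, h v) ᵥ* R + b) j) = _
  simp only [Pi.add_apply, Finset.sum_apply, Matrix.vecMul, dotProduct]

/-- For a fixed multiset size, aggregation and readout are linear, and `com` is an affine map
followed by `f`. -/
theorem isDifferentiable_ofMatrices {f : ℝ → ℝ}
    (hf : Differentiable ℝ f) (L d : ℕ) (C : Matrix (Fin d) (Fin d) ℝ)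
    (A : Fin k → Matrix (Fin d) (Fin d) ℝ) (R : Matrix (Fin d) (Fin d) ℝ) (b : Fin d → ℝ)
    (input : P ↪ Fin d) (output : Fin d) :
    (ofMatrices f L d C A R b input output).IsDifferentiable := by
  have hsum : ∀ (n : ℕ) (B : Matrix (Fin d) (Fin d) ℝ), Differentiable ℝ
      fun z : (Fin d → ℝ) × (Fin n → Fin d → ℝ) =>
        ((Finset.univ : Finset (Fin n)).val.map z.2).sum ᵥ* B := by
    intro n B
    change Differentiable ℝ fun z : (Fin d → ℝ) × (Fin n → Fin d → ℝ) => (∑ i, z.2 i) ᵥ* B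
    refine differentiable_pi.2 fun j => ?_
    simp only [Matrix.vecMul, dotProduct, Finset.sum_apply]
    fun_prop
  refine fun t => ⟨fun i n => hsum n (A i), fun n => hsum n R, ?_⟩
  change Differentiable ℝ fun z : (Fin d → ℝ) × (Fin k → Fin d → ℝ) × (Fin d → ℝ) =>
    fun j => f ((z.1 ᵥ* C + ∑ i, z.2.1 i + z.2.2 + b) j)
  refine differentiable_pi.2 fun j => hf.comp ?_
  simp only [Pi.add_apply, Matrix.vecMul, dotProduct, Finset.sum_apply]
  fun_prop

end SPMPNN

/-! ### Gates and the evaluation of node formulas -/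

namespace HopFormula

variable {k : ℕ} {P : Type*}

open Classical in
/-- The truth value of a node formula, as a real number. -/
noncomputable def value {V : Type*} (X : ColoredGraph V P) (φ : HopFormula k P) (u : V) : ℝ :=
  if φ.Realize X u then 1 else 0

open Classical in
/-- The weight with which the gate of a formula reads the value of `χ` at the node itself. -/
noncomputable def selfWeight : HopFormula k P → HopFormula k P → ℝ
  | color p, χ => if χ = color p then 1 else 0
  | tru, _ => 0
  | neg φ, χ => if χ = φ then -1 else 0
  | and φ ψ, χ => (if χ = φ then 1 else 0) + (if χ = ψ then 1 else 0)
  | count _ φ, χ => (if χ = φ (some 0) then 1 else 0) - (if χ = φ none then 1 else 0)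

open Classical in
/-- The weight with which the gate of a formula reads the values of `χ` at distance `i + 1`. -/
noncomputable def hopWeight (i : Fin k) : HopFormula k P → HopFormula k P → ℝ
  | count _ φ, χ => (if χ = φ (some i.succ) then 1 else 0) - (if χ = φ none then 1 else 0)
  | _, _ => 0

open Classical in
/-- The weight with which the gate of a formula reads the values of `χ` at all nodes. -/
noncomputable def readWeight : HopFormula k P → HopFormula k P → ℝ
  | count _ φ, χ => if χ = φ none then 1 else 0
  | _, _ => 0

/-- The bias of the gate of a formula. -/
noncomputable def bias : HopFormula k P → ℝ
  | color _ => 0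
  | tru => 1
  | neg _ => 1
  | and _ _ => -1
  | count N _ => 1 - N

/-- The number of nodes that a counting quantifier counts, split by hop classes. -/
theorem ncard_eq_sum_value {V : Type*} [Fintype V] (X : ColoredGraph V P)
    (φ : Option (Fin (k + 1)) → HopFormula k P) (u : V) :
    (({v : V | (φ (hopClass k X.graph u v)).Realize X v}.ncard : ℕ) : ℝ) =
      (φ (some 0)).value X u - (φ none).value X u
      + ∑ i : Fin k, ((∑ v ∈ hopNeighborhood X.graph ((i : ℕ) + 1) u, (φ (some i.succ)).value X v)
        - ∑ v ∈ hopNeighborhood X.graph ((i : ℕ) + 1) u, (φ none).value X v)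
      + ∑ v, (φ none).value X v := by
  classical
  -- Start from the value for class `none` at every node and correct it at the nodes within distance
  -- `k`; at most one correction is nonzero.
  have hterm : ∀ v, (φ (hopClass k X.graph u v)).value X v =
      (if u = v then (φ (some 0)).value X v - (φ none).value X v else 0)
      + ∑ i : Fin k, (if X.graph.edist u v = (((i : ℕ) + 1 : ℕ) : ℕ∞) then
        (φ (some i.succ)).value X v - (φ none).value X v else 0)
      + (φ none).value X v := by
    intro v
    have h : ∀ i : Fin k, X.graph.edist u v = (((i : ℕ) + 1 : ℕ) : ℕ∞) ↔
        hopClass k X.graph u v = some i.succ := fun i => by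
      rw [hopClass_eq_some_iff, Fin.val_succ]
    simp only [h, ← hopClass_eq_some_zero_iff (k := k) (G := X.graph)]
    rcases hopClass k X.graph u v with _ | j
    · simp
    · induction j using Fin.cases with
      | zero => simp [Fin.ext_iff]
      | succ j => simp
  have hcard : (({v : V | (φ (hopClass k X.graph u v)).Realize X v}.ncard : ℕ) : ℝ) =
      ∑ v, (φ (hopClass k X.graph u v)).value X v := by
    rw [Set.ncard_eq_toFinset_card', Set.toFinset_ofPred, Finset.card_filter]
    push_cast
    rfl
  rw [hcard, Finset.sum_congr rfl fun v _ => hterm v, Finset.sum_add_distrib,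
    Finset.sum_add_distrib, Finset.sum_comm]
  simp only [hopNeighborhood, Finset.sum_filter, ← Finset.sum_sub_distrib]
  simp only [Finset.sum_ite_eq, Finset.mem_univ, if_true]
  congr 2
  refine Finset.sum_congr rfl fun i _ => Finset.sum_congr rfl fun v _ => ?_
  split_ifs <;> simp

/-- If the values of its subformulas are read from `h`, then the gate of a formula outputs the
value of the formula. -/
theorem gate_eq_value {f : ℝ → ℝ} (hf₀ : ∀ n : ℤ, n ≤ 0 → f n = 0)
    (hf₁ : ∀ n : ℤ, 1 ≤ n → f n = 1) {S : Finset (HopFormula k P)} {V : Type*} [Fintype V]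
    (X : ColoredGraph V P) (h : V → HopFormula k P → ℝ) {φ : HopFormula k P} (hφ : φ ∈ S)
    (hS : φ.children ⊆ S) (hcolor : ∀ p, φ = color p → ∀ v, h v φ = φ.value X v)
    (hh : ∀ χ ∈ φ.children, ∀ v, h v χ = χ.value X v) (u : V) :
    f (∑ χ ∈ S, h u χ * φ.selfWeight χ
      + ∑ i : Fin k, ∑ χ ∈ S,
        (∑ v ∈ hopNeighborhood X.graph ((i : ℕ) + 1) u, h v χ) * φ.hopWeight i χ
      + ∑ χ ∈ S, (∑ v, h v χ) * φ.readWeight χ + φ.bias) = φ.value X u := by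
  classical
  cases φ with
  | color p =>
    simp only [selfWeight, hopWeight, readWeight, bias, mul_ite, mul_one, mul_zero,
      Finset.sum_ite_eq', hφ, if_true, Finset.sum_const_zero, add_zero, hcolor p rfl]
    unfold value
    split_ifs
    · simpa using hf₁ 1 le_rfl
    · simpa using hf₀ 0 le_rfl
  | tru =>
    simpa [selfWeight, hopWeight, readWeight, bias, value, Realize] using hf₁ 1 le_rfl
  | neg χ =>
    have hχ : χ ∈ S := hS (by simp [children])
    simp only [selfWeight, hopWeight, readWeight, bias, mul_ite, mul_zero,
      Finset.sum_ite_eq', hχ, if_true, Finset.sum_const_zero, add_zero,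
      hh χ (by simp [children])]
    by_cases hr : χ.Realize X u
    · simpa [value, Realize, hr] using hf₀ 0 le_rfl
    · simpa [value, Realize, hr] using hf₁ 1 le_rfl
  | and χ ξ =>
    have hχ : χ ∈ S := hS (by simp [children])
    have hξ : ξ ∈ S := hS (by simp [children])
    -- The weights add up, so `χ = ξ` needs no separate case.
    simp only [selfWeight, hopWeight, readWeight, bias, mul_add, mul_ite, mul_one, mul_zero,
      Finset.sum_add_distrib, Finset.sum_ite_eq', hχ, hξ, if_true, Finset.sum_const_zero, add_zero,
      hh χ (by simp [children]), hh ξ (by simp [children])]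
    by_cases hr : χ.Realize X u <;> by_cases hr' : ξ.Realize X u
    · simpa [value, Realize, hr, hr'] using hf₁ 1 le_rfl
    · simpa [value, Realize, hr, hr'] using hf₀ 0 le_rfl
    · simpa [value, Realize, hr, hr'] using hf₀ 0 le_rfl
    · simpa [value, Realize, hr, hr'] using hf₀ (-1) (by norm_num)
  | count N χ =>
    have hχ : ∀ r, χ r ∈ S := fun r => hS (by simp [children])
    have hv : ∀ r v, h v (χ r) = (χ r).value X v := fun r => hh _ (by simp [children])
    simp only [selfWeight, hopWeight, readWeight, bias, mul_sub, mul_ite, mul_one, mul_zero,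
      Finset.sum_sub_distrib, Finset.sum_ite_eq', hχ, if_true, hv]
    rw [← Finset.sum_sub_distrib, ← ncard_eq_sum_value]
    set c := {v : V | (χ (hopClass k X.graph u v)).Realize X v}.ncard
    -- The bias `1 - N` makes the integer `c + 1 - N` at least `1` exactly when `N ≤ c`.
    have hcast : (c : ℝ) + (1 - (N : ℝ)) = (((c : ℤ) + 1 - N : ℤ) : ℝ) := by
      push_cast
      ring
    rw [hcast]
    by_cases hN : N ≤ c
    · rw [hf₁ _ (by omega), value, if_pos (show (count N χ).Realize X u from hN)]
    · rw [hf₀ _ (by omega), value, if_neg (show ¬ (count N χ).Realize X u from hN)]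

theorem depth_lt_of_mem_children {φ χ : HopFormula k P} (h : χ ∈ φ.children) :
    χ.depth < φ.depth := by
  classical
  cases φ with
  | color p => simp [children] at h
  | tru => simp [children] at h
  | neg φ => simp_all [children, depth]
  | and φ ψ =>
    rcases (by simpa [children] using h : χ = φ ∨ χ = ψ) with rfl | rfl <;>
      simp only [depth] <;> omega
  | count N φ =>
    obtain ⟨r, rfl⟩ := (by simpa [children] using h : ∃ r, φ r = χ)
    exact Nat.lt_succ_of_le (Finset.le_sup (f := fun r => (φ r).depth) (Finset.mem_univ r))

theorem eq_color_of_depth_eq_zero {φ : HopFormula k P} (h : φ.depth = 0) : ∃ p, φ = color p := by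
  cases φ <;> simp_all [depth]

/-- Every node formula is evaluated by a homogeneous network whose activation function maps the
integers `n ≤ 0` to `0` and the integers `n ≥ 1` to `1`. -/
theorem exists_ofMatrices [Finite P] (φ : HopFormula k P) :
    ∃ (L d : ℕ) (C : Matrix (Fin d) (Fin d) ℝ) (A : Fin k → Matrix (Fin d) (Fin d) ℝ)
      (R : Matrix (Fin d) (Fin d) ℝ) (b : Fin d → ℝ) (input : P ↪ Fin d) (output : Fin d),
      ∀ f : ℝ → ℝ, (∀ n : ℤ, n ≤ 0 → f n = 0) → (∀ n : ℤ, 1 ≤ n → f n = 1) →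
        ∀ (V : Type) [Fintype V] (X : ColoredGraph V P) (u : V),
          (SPMPNN.ofMatrices f L d C A R b input output).Accepts X u ↔ φ.Realize X u := by
  classical
  have := Fintype.ofFinite P
  obtain ⟨S₀, hφ₀, hcl₀⟩ := φ.exists_closed_finset
  -- Colors absent from `φ` also need a coordinate, because `input` embeds the whole palette.
  let S := S₀ ∪ Finset.univ.image color
  have hφ : φ ∈ S := Finset.mem_union_left _ hφ₀
  have hcol : ∀ p, color p ∈ S := fun p =>
    Finset.mem_union_right _ (Finset.mem_image_of_mem _ (Finset.mem_univ p))
  have hcl : ∀ ψ ∈ S, ψ.children ⊆ S := by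
    intro ψ hψ
    rcases Finset.mem_union.1 hψ with hψ | hψ
    · exact (hcl₀ ψ hψ).trans Finset.subset_union_left
    · obtain ⟨p, -, rfl⟩ := Finset.mem_image.1 hψ
      simp [children]
  let e : S ≃ Fin S.card := S.equivFin
  let g : Fin S.card → HopFormula k P := fun j => (e.symm j).1
  have hge : ∀ ψ (h : ψ ∈ S), g (e ⟨ψ, h⟩) = ψ := fun ψ h => by simp [g]
  have heg : ∀ j h, e ⟨g j, h⟩ = j := fun j h => by simp [g]
  have hgS : ∀ j, g j ∈ S := fun j => (e.symm j).2
  refine ⟨φ.depth, S.card, .of fun i j => (g j).selfWeight (g i),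
    fun l => .of fun i j => (g j).hopWeight l (g i), .of fun i j => (g j).readWeight (g i),
    fun j => (g j).bias, ⟨fun p => e ⟨color p, hcol p⟩, fun p q h => by simpa using h⟩,
    e ⟨φ, hφ⟩, fun f hf₀ hf₁ V _ X u => ?_⟩
  set M := SPMPNN.ofMatrices f φ.depth S.card _ _ _ _ _ _
  let st : ℕ → V → Fin S.card → ℝ := M.state X
  have hsum : ∀ F : HopFormula k P → ℝ, ∑ j, F (g j) = ∑ χ ∈ S, F χ := by
    intro F
    rw [← Finset.sum_coe_sort S]
    exact e.symm.sum_comp fun χ : S => F χ.1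
  have key : ∀ t v j, (g j).depth ≤ t → st t v j = (g j).value X v := by
    intro t
    induction t with
    | zero =>
      intro v j hj
      -- Only colors are correct initially; the coordinate of `tru` starts at `0` and is set by its
      -- bias, hence its depth `1`.
      obtain ⟨p, hp⟩ := eq_color_of_depth_eq_zero (Nat.le_zero.1 hj)
      have hj' : j = e ⟨color p, hcol p⟩ := by
        rw [← heg j (hgS j)]
        simp only [hp]
      rw [hp, hj']
      exact M.state_zero_input X v p
    | succ t ih =>
      intro v j hj
      let h : V → HopFormula k P → ℝ := fun w χ => if hχ : χ ∈ S then st t w (e ⟨χ, hχ⟩) else 0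
      have hst : ∀ w i, st t w i = h w (g i) := fun w i => by simp [h, hgS, heg]
      have hval : ∀ χ ∈ S, χ.depth ≤ t → ∀ w, h w χ = χ.value X w := fun χ hχ hd w => by
        simp only [h, hχ, dif_pos]
        rw [ih w _ (by rwa [hge]), hge]
      -- A color gate reads itself, so colors persist through the identical layers; every other gate
      -- reads only formulas of smaller depth.
      rw [← gate_eq_value hf₀ hf₁ X h (hgS j) (hcl _ (hgS j))
        (fun p hp => hval _ (hgS j) (by simp [hp, depth]))
        (fun χ hχ => hval χ (hcl _ (hgS j) hχ)
          (Nat.lt_succ_iff.1 ((depth_lt_of_mem_children hχ).trans_le hj)))]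
      have hsucc : st (t + 1) v j = f (∑ i, st t v i * (g j).selfWeight (g i)
          + ∑ l : Fin k, ∑ i, (∑ w ∈ hopNeighborhood X.graph ((l : ℕ) + 1) v, st t w i)
            * (g j).hopWeight l (g i)
          + ∑ i, (∑ w, st t w i) * (g j).readWeight (g i) + (g j).bias) :=
        SPMPNN.state_ofMatrices_succ ..
      rw [hsucc]
      simp only [hst]
      rw [hsum fun χ => h v χ * (g j).selfWeight χ,
        hsum fun χ => (∑ w, h w χ) * (g j).readWeight χ,
        Finset.sum_congr rfl fun (l : Fin k) _ => hsum fun χ =>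
          (∑ w ∈ hopNeighborhood X.graph ((l : ℕ) + 1) v, h w χ) * (g j).hopWeight l χ]
  have hout : M.state X M.depth u M.output = φ.value X u := by
    have := key φ.depth u (e ⟨φ, hφ⟩) (by rw [hge])
    rwa [hge] at this
  rw [SPMPNN.Accepts, hout, value]
  split_ifs with hr <;> simp only [hr, iff_true, iff_false] <;> norm_num

end HopFormula

theorem theorem2 (k : ℕ) (hk : 1 ≤ k) (P : Type*) [Finite P]
    (x : Fin 2) (φ : C2Formula k P) (hφ : φ.freeVars ⊆ {x}) :
    (∃ M : SPMPNN k P, M.IsDifferentiable ∧ M.Captures φ x) ∧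
    (∃ (L d : ℕ) (C : Matrix (Fin d) (Fin d) ℝ) (A : Fin k → Matrix (Fin d) (Fin d) ℝ)
      (R : Matrix (Fin d) (Fin d) ℝ) (b : Fin d → ℝ) (input : P ↪ Fin d) (output : Fin d),
      (SPMPNN.ofMatrices truncReLU L d C A R b input output).Captures φ x) := by
  obtain ⟨ψ, hψ⟩ := φ.exists_hopFormula hk hφ
  obtain ⟨L, d, C, A, R, b, input, output, h⟩ := ψ.exists_ofMatrices
  refine ⟨⟨.ofMatrices Real.smoothTransition L d C A R b input output,
    SPMPNN.isDifferentiable_ofMatrices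
      ((Real.smoothTransition.contDiff (n := 1)).differentiable (by norm_num)) L d C A R b input output, fun V _ X a => ?_⟩,
    L, d, C, A, R, b, input, output, fun V _ X a => ?_⟩
  · rw [h _ (fun n hn => Real.smoothTransition.zero_of_nonpos (by exact_mod_cast hn))
      (fun n hn => Real.smoothTransition.one_of_one_le (by exact_mod_cast hn)), hψ]
  · rw [h _ (fun n hn => ?_) (fun n hn => ?_), hψ]
    · have hn' : (n : ℝ) ≤ 0 := by exact_mod_cast hn
      exact max_eq_left ((min_le_left _ _).trans hn')
    · have hn' : (1 : ℝ) ≤ n := by exact_mod_cast hn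
      simp [truncReLU, min_eq_right hn']
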